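/- Let $N_R,N_T,L$ be integers with $1\le L\le\min(N_R,N_T)$, and let $\mathbf H$ be a random $N_R\times N_T$ complex matrix whose entries are i.i.d. circularly symmetric complex Gaussian random variables with zero mean and unit variance (an i.i.d. Rayleigh fading channel). An antenna selection policy is a measurable function $\varphi$ on $\mathbb C^{N_R\times N_T}$ that takes values in the finite set of $L$-element subsets of $\{1,\dots,N_T\}$. For a subset $j$, let $\mathbf H_j\in\mathbb C^{N_R\times L}$ consist of the columns of $\mathbf H$ indexed by $j$, in increasing order, and let $\mathbf Q_j=\mathbf H_j^{\mathrm H}\mathbf H_j$, which is almost surely invertible. For $\rho_0>0$, the post-processing SNR of the $k$th data stream under a zero-forcing front end is $$\rho_k^{(j)}=\frac{\rho_0/L}{[\mathbf Q_j^{-1}]_{kk}},\qquad 1\le k\le L,$$ and $\bar\rho^{(j)}=\max_{1\le k\le L}\rho_k^{(j)}$. Then, for every antenna selection policy $\varphi$ and every threshold $\gamma>0$, with $j=\varphi(\mathbf H)$, $$\bar d^{(j)}:=\limsup_{\rho_0\to\infty}\frac{\ln P\bigl(\bar\rho^{(j)}\le\gamma\bigr)}{\ln\rho_0^{-1}}\;\le\;(N_T-L+1)(N_R-L+1).$$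 -/

import Mathlib

open MeasureTheory ProbabilityTheory Filter
open scoped Matrix NNReal

/-- The circularly symmetric complex Gaussian law with zero mean and unit variance: the real and
imaginary parts are independent real Gaussians of mean `0` and variance `1 / 2`. -/
noncomputable def stdComplexGaussian : Measure ℂ :=
  ((gaussianReal 0 (1 / 2 : ℝ≥0)).prod (gaussianReal 0 (1 / 2 : ℝ≥0))).map
    Complex.measurableEquivRealProd.symm

/-- Complex matrices carry the product (equivalently, Borel) σ-algebra. -/
noncomputable instance (NR NT : ℕ) : MeasurableSpace (Matrix (Fin NR) (Fin NT) ℂ) := MeasurableSpace.pi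

/-- `H` is an i.i.d. Rayleigh fading channel: its entries are independent, circularly symmetric
complex Gaussian random variables with zero mean and unit variance. -/
structure IsRayleighChannel {Ω : Type*} [MeasurableSpace Ω] (P : Measure Ω) {NR NT : ℕ}
    (H : Ω → Matrix (Fin NR) (Fin NT) ℂ) : Prop where
  hasLaw : ∀ r t, HasLaw (fun ω => H ω r t) stdComplexGaussian P
  indep : iIndepFun (fun (p : Fin NR × Fin NT) ω => H ω p.1 p.2) P

/-- The sets of `L` out of `NT` transmit antennas. -/
def AntennaSubset (NT L : ℕ) : Type := {S : Finset (Fin NT) // S.card = L}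

/-- The (finite) set of antenna subsets carries the discrete σ-algebra. -/
instance (NT L : ℕ) : MeasurableSpace (AntennaSubset NT L) := ⊤

/-- The matrix consisting of the columns of `H` in the antenna subset `j`, in increasing order. -/
def selectedChannel {NR NT L : ℕ} (H : Matrix (Fin NR) (Fin NT) ℂ) (j : AntennaSubset NT L) :
    Matrix (Fin NR) (Fin L) ℂ :=
  H.submatrix id (j.1.orderEmbOfFin j.2)

/-- The post-processing SNR `(ρ₀ / L) / [Q⁻¹]ₖₖ`, `Q = Aᴴ A`, of stream `k` for the zero-forcing
front end with (selected) channel matrix `A` and SNR `ρ₀`. -/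
noncomputable def postSNR {NR L : ℕ} (A : Matrix (Fin NR) (Fin L) ℂ) (ρ₀ : ℝ) (k : Fin L) : ℝ :=
  (ρ₀ / L) / ((Aᴴ * A)⁻¹ k k).re

/-- The maximal post-processing SNR over all streams. -/
noncomputable def maxPostSNR {NR L : ℕ} (A : Matrix (Fin NR) (Fin L) ℂ) (ρ₀ : ℝ) : ℝ :=
  ⨆ k : Fin L, postSNR A ρ₀ k

/-- The exponent `limsup_{ρ₀ → ∞} ln P(maximal post-processing SNR ≤ γ) / ln ρ₀⁻¹` under the antenna
selection policy `φ`, as an extended real number. `ENNReal.log` is the natural logarithm with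
`ENNReal.log 0 = -∞`, so that an outage probability zero counts as the exponent `+∞`. -/
noncomputable def diversityUpper {Ω : Type*} [MeasurableSpace Ω] (P : Measure Ω) {NR NT L : ℕ}
    (H : Ω → Matrix (Fin NR) (Fin NT) ℂ)
    (φ : Matrix (Fin NR) (Fin NT) ℂ → AntennaSubset NT L) (γ : ℝ) : EReal :=
  limsup (fun ρ₀ : ℝ =>
    ENNReal.log (P {ω | maxPostSNR (selectedChannel (H ω) (φ (H ω))) ρ₀ ≤ γ}) /
      ((Real.log ρ₀⁻¹ : ℝ) : EReal)) atTop

/-! Put `m = L - 1`. If `H` is within `δ` of a matrix of rank `m`, any `L` of its columns are nearly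
dependent. Since `1 / [Q⁻¹]ₖₖ` is the squared distance from column `k` to the span of the others, a
dependence with all coefficients bounded away from zero makes every stream's SNR `O(ρ₀ δ²)`. This
holds for all antenna subsets at once, so no policy escapes it. Matrices of rank at most `m` have
complex codimension `(NR - m) * (NT - m)`, so such an event has probability at least of order `(δ²)
^ ((NR - m) * (NT - m))`; taking `δ²` proportional to `1 / ρ₀` gives the exponent.
`postSNR_mul_norm_sq_le` turns near-dependence into an SNR bound, `det_mul_mulVec_signedMinors`
supplies the dependence, and `pi_stdComplexGaussian_lower_bound` the probability. -/

/-! ### Gaussian small-ball lower bounds -/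

theorem gaussianReal_Ioo_lower_bound (R : ℝ) : ∃ c : ℝ, 0 < c ∧ ∀ a δ : ℝ, |a| ≤ R → 0 < δ → δ ≤ 1 →
    ENNReal.ofReal (c * δ) ≤ gaussianReal 0 (1 / 2 : ℝ≥0) (Set.Ioo (a - δ) (a + δ)) := by
  -- The density decreases in `|x|`, and the interval, of length `2 * δ`, stays within `|x| ≤ |R| +
  -- 1`.
  refine ⟨2 * gaussianPDFReal 0 (1 / 2 : ℝ≥0) (|R| + 1),
    mul_pos two_pos (gaussianPDFReal_pos _ _ _ (by norm_num)), fun a δ ha hδ hδ1 => ?_⟩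
  rw [gaussianReal_apply 0 (by norm_num)]
  have hle : ∀ x ∈ Set.Ioo (a - δ) (a + δ),
      ENNReal.ofReal (gaussianPDFReal 0 (1 / 2 : ℝ≥0) (|R| + 1)) ≤
        gaussianPDF 0 (1 / 2 : ℝ≥0) x := by
    intro x hx
    refine ENNReal.ofReal_le_ofReal ?_
    have hx' : |x| ≤ |(|R| + 1)| := by
      have h1 := abs_le.1 ha
      have h2 := le_abs_self R
      rw [abs_of_nonneg (by positivity : 0 ≤ |R| + 1), abs_le]
      constructor <;> linarith [hx.1, hx.2]
    unfold gaussianPDFReal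
    have := sq_le_sq.2 hx'
    simp only [sub_zero]
    gcongr
  calc ENNReal.ofReal (2 * gaussianPDFReal 0 (1 / 2 : ℝ≥0) (|R| + 1) * δ)
      = ∫⁻ _ in Set.Ioo (a - δ) (a + δ),
          ENNReal.ofReal (gaussianPDFReal 0 (1 / 2 : ℝ≥0) (|R| + 1)) := by
        rw [setLIntegral_const, Real.volume_Ioo,
          ← ENNReal.ofReal_mul (gaussianPDFReal_nonneg _ _ _)]
        congr 1
        ring
    _ ≤ _ := setLIntegral_mono' measurableSet_Ioo hle

theorem stdComplexGaussian_ball_lower_bound (R : ℝ) : ∃ c : ℝ, 0 < c ∧ ∀ (z : ℂ) (δ : ℝ), ‖z‖ ≤ R →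
    0 < δ → δ ≤ 1 →
    ENNReal.ofReal (c * δ ^ 2) ≤ stdComplexGaussian (Metric.ball z δ) := by
  obtain ⟨c, hc, h⟩ := gaussianReal_Ioo_lower_bound R
  refine ⟨c ^ 2 / 4, by positivity, fun z δ hz hδ hδ1 => ?_⟩
  have hre := h z.re (δ / 2) ((Complex.abs_re_le_norm z).trans hz) (by linarith) (by linarith)
  have him := h z.im (δ / 2) ((Complex.abs_im_le_norm z).trans hz) (by linarith) (by linarith)
  rw [stdComplexGaussian, MeasurableEquiv.map_apply]
  refine le_trans ?_ (measure_mono (?_ : Set.Ioo (z.re - δ / 2) (z.re + δ / 2) ×ˢ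
    Set.Ioo (z.im - δ / 2) (z.im + δ / 2) ⊆ _))
  · rw [Measure.prod_prod]
    refine le_trans (le_of_eq ?_) (mul_le_mul' hre him)
    rw [← ENNReal.ofReal_mul (by positivity)]
    congr 1
    ring
  · rintro ⟨x, y⟩ ⟨hx, hy⟩
    simp only [Set.mem_preimage, Metric.mem_ball, Complex.dist_eq]
    refine (Complex.norm_le_abs_re_add_abs_im _).trans_lt ?_
    have h1 : |x - z.re| < δ / 2 := abs_lt.2 ⟨by linarith [hx.1], by linarith [hx.2]⟩
    have h2 : |y - z.im| < δ / 2 := abs_lt.2 ⟨by linarith [hy.1], by linarith [hy.2]⟩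
    have : |x - z.re| + |y - z.im| < δ := by linarith
    simpa using this

instance : IsProbabilityMeasure stdComplexGaussian :=
  Measure.isProbabilityMeasure_map (MeasurableEquiv.measurable _).aemeasurable

instance : stdComplexGaussian.IsOpenPosMeasure where
  open_pos U hU hne := by
    obtain ⟨z, hz⟩ := hne
    obtain ⟨δ, hδ, hb⟩ := Metric.isOpen_iff.1 hU z hz
    obtain ⟨c, hc, h⟩ := stdComplexGaussian_ball_lower_bound ‖z‖
    have hm : 0 < min δ 1 := lt_min hδ one_pos
    have := h z (min δ 1) le_rfl hm (min_le_right _ _)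
    refine (lt_of_lt_of_le (ENNReal.ofReal_pos.2 (by positivity)) (this.trans (measure_mono
      ((Metric.ball_subset_ball (min_le_left _ _)).trans hb)))).ne'

/-! ### Test vectors for the zero-forcing SNR -/

theorem norm_sq_star_dotProduct_le {n : Type*} [Fintype n] (w u : n → ℂ) :
    ‖star w ⬝ᵥ u‖ ^ 2 ≤ (∑ r, ‖w r‖ ^ 2) * ∑ r, ‖u r‖ ^ 2 := by
  calc ‖star w ⬝ᵥ u‖ ^ 2 ≤ (∑ r, ‖w r‖ * ‖u r‖) ^ 2 := by
        gcongr
        refine (norm_sum_le _ _).trans (le_of_eq ?_)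
        simp
    _ ≤ _ := Finset.sum_mul_sq_le_sq_mul_sq _ _ _

/-- The vector `w = A Q⁻¹ eₖ` satisfies `⟨w, A v⟩ = v k` and `‖w‖² = [Q⁻¹]ₖₖ`; apply Cauchy–Schwarz.
-/
theorem postSNR_mul_norm_sq_le {NR L : ℕ} (A : Matrix (Fin NR) (Fin L) ℂ) {ρ₀ : ℝ} (hρ : 0 ≤ ρ₀)
    (k : Fin L) (v : Fin L → ℂ) :
    postSNR A ρ₀ k * ‖v k‖ ^ 2 ≤ (ρ₀ / L) * ∑ r, ‖(A *ᵥ v) r‖ ^ 2 := by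
  have hS : 0 ≤ (ρ₀ / L) * ∑ r, ‖(A *ᵥ v) r‖ ^ 2 := by positivity
  by_cases hdet : IsUnit (Aᴴ * A).det
  · set Q := Aᴴ * A with hQ
    have hQinv : (Q⁻¹)ᴴ = Q⁻¹ := (Matrix.isHermitian_conjTranspose_mul_self A).inv
    set w := A *ᵥ (Q⁻¹ *ᵥ Pi.single k 1) with hw
    have hstar : star w = (Pi.single k 1 ᵥ* Q⁻¹) ᵥ* Aᴴ := by
      rw [hw, Matrix.star_mulVec, Matrix.star_mulVec, hQinv]
      congr 2
      ext i
      by_cases h : i = k <;> simp [h]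
    have key : ∀ u, star w ⬝ᵥ (A *ᵥ u) = u k := by
      intro u
      rw [hstar, ← Matrix.dotProduct_mulVec, Matrix.mulVec_mulVec, ← hQ,
        ← Matrix.dotProduct_mulVec, Matrix.mulVec_mulVec, Matrix.nonsing_inv_mul _ hdet]
      simp
    have hww : ((Q⁻¹ k k).re : ℝ) = ∑ r, ‖w r‖ ^ 2 := by
      have h1 : star w ⬝ᵥ w = Q⁻¹ k k := by
        conv_lhs => rw [hw]
        rw [key]
        simp
      rw [← h1]
      simp [dotProduct, ← Complex.normSq_eq_norm_sq, Complex.normSq_apply]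
    have hcs := norm_sq_star_dotProduct_le w (A *ᵥ v)
    rw [key, ← hww] at hcs
    unfold postSNR
    rw [← hQ]
    have hq : 0 ≤ (Q⁻¹ k k).re := hww ▸ by positivity
    rcases hq.eq_or_lt with h0 | h0
    · rw [← h0]
      simpa using hS
    · rw [div_mul_eq_mul_div, div_le_iff₀ h0, mul_assoc]
      gcongr
      linarith
  -- For singular `Q` the inverse is zero by convention, and division by zero makes the SNR zero.
  · simpa [postSNR, Matrix.nonsing_inv_apply_not_isUnit _ hdet] using hS

/-- The signed maximal minors of an `m × (m + 1)` matrix. -/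
def signedMinors {m : ℕ} (T : Matrix (Fin m) (Fin (m + 1)) ℂ) (i : Fin (m + 1)) : ℂ :=
  (-1) ^ (i : ℕ) * (T.submatrix id i.succAbove).det

/-- Repeating row `s` on top of `T` gives a zero determinant; expand it along that top row. -/
theorem mulVec_signedMinors {m : ℕ} (T : Matrix (Fin m) (Fin (m + 1)) ℂ) :
    T *ᵥ signedMinors T = 0 := by
  ext s
  have h : (Matrix.of (Fin.cons (T s) T) : Matrix (Fin (m + 1)) (Fin (m + 1)) ℂ).det = 0 :=
    Matrix.det_zero_of_row_eq (Fin.succ_ne_zero s).symm rfl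
  rw [Matrix.det_succ_row_zero] at h
  rw [Pi.zero_apply, ← h, Matrix.mulVec, dotProduct]
  refine Finset.sum_congr rfl fun i _ => ?_
  have : (Matrix.of (Fin.cons (T s) T) : Matrix (Fin (m + 1)) (Fin (m + 1)) ℂ).submatrix Fin.succ
      i.succAbove = T.submatrix id i.succAbove := rfl
  have h0 : (Matrix.of (Fin.cons (T s) T) : Matrix (Fin (m + 1)) (Fin (m + 1)) ℂ) 0 i = T s i := rfl
  rw [this, h0, signedMinors]
  ring

/-! ### Gaussian mass of a tube around a graph -/

-- By Fubini, each `x` in `U` contributes a polydisc of radius `δ` about `f x`, hence a factor `δ ^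
-- 2` for each complex coordinate of `y`.
open scoped Topology in
theorem pi_stdComplexGaussian_lower_bound {ι : Type*} [Fintype ι] (p : ι → Prop) [DecidablePred p]
    {x₀ : {i // p i} → ℂ} {U : Set ({i // p i} → ℂ)} (hU : U ∈ 𝓝 x₀)
    (f : ({i // p i} → ℂ) → {i // ¬ p i} → ℂ) (R : ℝ) (hf : ∀ x ∈ U, ∀ i, ‖f x i‖ ≤ R) :
    ∃ c : ℝ, 0 < c ∧ ∀ δ : ℝ, 0 < δ → δ ≤ 1 → ∀ S : Set (ι → ℂ),
      (∀ x ∈ U, ∀ y, (∀ i, ‖y i - f x i‖ < δ) →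
        (Equiv.piEquivPiSubtypeProd p fun _ => ℂ).symm (x, y) ∈ S) →
      ENNReal.ofReal (c * (δ ^ 2) ^ Fintype.card {i // ¬ p i}) ≤
        Measure.pi (fun _ : ι => stdComplexGaussian) S := by
  obtain ⟨c, hc, hball⟩ := stdComplexGaussian_ball_lower_bound R
  set μ : Measure ({i // p i} → ℂ) := Measure.pi fun _ => stdComplexGaussian
  set ν : Measure ({i // ¬ p i} → ℂ) := Measure.pi fun _ => stdComplexGaussian
  have hμU : 0 < μ U := Measure.measure_pos_of_mem_nhds μ hU
  have hμU' : μ U ≠ ⊤ := measure_ne_top μ U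
  refine ⟨(μ U).toReal * c ^ Fintype.card {i // ¬ p i},
    mul_pos (ENNReal.toReal_pos hμU.ne' hμU') (pow_pos hc _), fun δ hδ hδ1 S hS => ?_⟩
  have hmp := measurePreserving_piEquivPiSubtypeProd (fun _ : ι => stdComplexGaussian) p
  rw [← (hmp.symm _).measure_preimage_equiv]
  set S' := (MeasurableEquiv.piEquivPiSubtypeProd (fun _ : ι => ℂ) p).symm ⁻¹' S
  have hsec : ∀ x ∈ U, ENNReal.ofReal ((c * δ ^ 2) ^ Fintype.card {i // ¬ p i}) ≤
      ν (Prod.mk x ⁻¹' toMeasurable (μ.prod ν) S') := by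
    intro x hx
    calc ENNReal.ofReal ((c * δ ^ 2) ^ Fintype.card {i // ¬ p i})
        = ∏ _i : {i // ¬ p i}, ENNReal.ofReal (c * δ ^ 2) := by
          rw [Finset.prod_const, Finset.card_univ, ENNReal.ofReal_pow (by positivity)]
      _ ≤ ∏ i : {i // ¬ p i}, stdComplexGaussian (Metric.ball (f x i) δ) :=
          Finset.prod_le_prod' fun i _ => hball _ _ (hf x hx i) hδ hδ1
      _ = ν (Set.univ.pi fun i => Metric.ball (f x i) δ) := (Measure.pi_pi _ _).symm
      _ ≤ _ := measure_mono fun y hy => subset_toMeasurable (μ.prod ν) S' (hS x hx y fun i => by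
          simpa [dist_eq_norm] using hy i (Set.mem_univ i))
  change _ ≤ (μ.prod ν) S'
  -- Neither `S` nor `f` is assumed measurable, so Fubini is applied to a measurable hull of equal
  -- measure.
  rw [← measure_toMeasurable S', Measure.prod_apply (measurableSet_toMeasurable _ _)]
  calc ENNReal.ofReal ((μ U).toReal * c ^ Fintype.card {i // ¬ p i} *
        (δ ^ 2) ^ Fintype.card {i // ¬ p i})
      = ENNReal.ofReal ((c * δ ^ 2) ^ Fintype.card {i // ¬ p i}) * μ U := by
        rw [mul_assoc, ← mul_pow, ENNReal.ofReal_mul ENNReal.toReal_nonneg,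
          ENNReal.ofReal_toReal hμU', mul_comm]
    _ = ∫⁻ _ in U, ENNReal.ofReal ((c * δ ^ 2) ^ Fintype.card {i // ¬ p i}) ∂μ := by
        rw [setLIntegral_const]
    _ ≤ ∫⁻ x in U, ν (Prod.mk x ⁻¹' toMeasurable (μ.prod ν) S') ∂μ :=
        setLIntegral_mono (measurable_measure_prodMk_left (measurableSet_toMeasurable _ _)) hsec
    _ ≤ _ := setLIntegral_le_lintegral _ _

/-! ### Matrices near rank `m`: Schur complements and minors -/

section LowRank

variable {NR NT m : ℕ} (hR : m ≤ NR) (hT : m ≤ NT)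

/-- The first `m` rows of a matrix. -/
def topRows (H : Matrix (Fin NR) (Fin NT) ℂ) : Matrix (Fin m) (Fin NT) ℂ :=
  H.submatrix (Fin.castLE hR) id

/-- The leading `m × m` block of a matrix. -/
def leadingBlock (H : Matrix (Fin NR) (Fin NT) ℂ) : Matrix (Fin m) (Fin m) ℂ :=
  H.submatrix (Fin.castLE hR) (Fin.castLE hT)

/-- The entry `(r, t)` that a matrix with the same first `m` rows and columns and of rank `m` would
have, multiplied by the determinant of the leading block. -/
noncomputable def scaledPrediction (H : Matrix (Fin NR) (Fin NT) ℂ) (r : Fin NR) (t : Fin NT) : ℂ :=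
  (fun s => H r (Fin.castLE hT s)) ⬝ᵥ
    ((leadingBlock hR hT H).adjugate *ᵥ fun s => topRows hR H s t)

/-- The deviation of the entry `(r, t)` from its rank `m` prediction, multiplied by the determinant
of the leading block. -/
noncomputable def scaledResidual (H : Matrix (Fin NR) (Fin NT) ℂ) (r : Fin NR) (t : Fin NT) : ℂ :=
  (leadingBlock hR hT H).det * H r t - scaledPrediction hR hT H r t

theorem scaledResidual_of_lt_row (H : Matrix (Fin NR) (Fin NT) ℂ) {r : Fin NR} (hr : (r : ℕ) < m)
    (t : Fin NT) : scaledResidual hR hT H r t = 0 := by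
  obtain ⟨s, rfl⟩ : ∃ s : Fin m, r = Fin.castLE hR s := ⟨⟨r, hr⟩, rfl⟩
  have h : (leadingBlock hR hT H *ᵥ ((leadingBlock hR hT H).adjugate *ᵥ
      fun s => topRows hR H s t)) s = (leadingBlock hR hT H).det * topRows hR H s t := by
    rw [Matrix.mulVec_mulVec, Matrix.mul_adjugate, Matrix.smul_mulVec, Matrix.one_mulVec]
    rfl
  exact sub_eq_zero.2 h.symm

theorem scaledResidual_of_lt_col (H : Matrix (Fin NR) (Fin NT) ℂ) (r : Fin NR) {t : Fin NT}
    (ht : (t : ℕ) < m) : scaledResidual hR hT H r t = 0 := by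
  obtain ⟨s, rfl⟩ : ∃ s : Fin m, t = Fin.castLE hT s := ⟨⟨t, ht⟩, rfl⟩
  have h : (leadingBlock hR hT H).adjugate *ᵥ (fun s' => topRows hR H s' (Fin.castLE hT s)) =
      Pi.single s (leadingBlock hR hT H).det := by
    ext i
    have := congrFun (congrFun (Matrix.adjugate_mul (leadingBlock hR hT H)) i) s
    rw [Matrix.mul_apply, Matrix.smul_apply, Matrix.one_apply] at this
    rw [Pi.single_apply]
    refine Eq.trans this ?_
    by_cases h : i = s <;> simp [h]
  rw [scaledResidual, scaledPrediction, h, dotProduct_single, mul_comm, sub_self]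

/-- The prediction of an entry is linear in the top part of its column, and the signed minors
annihilate the top rows; only the residuals survive. -/
theorem det_mul_mulVec_signedMinors (H : Matrix (Fin NR) (Fin NT) ℂ) (e : Fin (m + 1) → Fin NT)
    (r : Fin NR) :
    (leadingBlock hR hT H).det *
        (H.submatrix id e *ᵥ signedMinors ((topRows hR H).submatrix id e)) r =
      ∑ i, scaledResidual hR hT H r (e i) * signedMinors ((topRows hR H).submatrix id e) i := by
  set v := signedMinors ((topRows hR H).submatrix id e)
  have h : ∑ i, scaledPrediction hR hT H r (e i) * v i = 0 := by
    have h2 : (fun s => H r (Fin.castLE hT s)) ⬝ᵥ ((leadingBlock hR hT H).adjugate *ᵥ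
        ((topRows hR H).submatrix id e *ᵥ v)) = 0 := by
      rw [mulVec_signedMinors, Matrix.mulVec_zero, dotProduct_zero]
    rw [Matrix.mulVec_mulVec, Matrix.dotProduct_mulVec] at h2
    rw [← h2]
    refine Finset.sum_congr rfl fun i _ => ?_
    congr 1
  simp only [scaledResidual, sub_mul, Finset.sum_sub_distrib, h, sub_zero, mul_assoc,
    ← Finset.mul_sum]
  rfl

/-- The constant by which the post-processing SNR of stream `k` is controlled through the
squared size of the residuals. -/
noncomputable def residualGain (H : Matrix (Fin NR) (Fin NT) ℂ) (e : Fin (m + 1) → Fin NT)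
    (k : Fin (m + 1)) : ℝ :=
  NR * ((∑ i, ‖signedMinors ((topRows hR H).submatrix id e) i‖) /
    ‖(leadingBlock hR hT H).det‖) ^ 2 / ‖signedMinors ((topRows hR H).submatrix id e) k‖ ^ 2

theorem postSNR_le_residualGain (H : Matrix (Fin NR) (Fin NT) ℂ) (e : Fin (m + 1) → Fin NT)
    (k : Fin (m + 1)) {ε ρ₀ : ℝ} (hρ : 0 ≤ ρ₀)
    (hdet : (leadingBlock hR hT H).det ≠ 0)
    (hk : signedMinors ((topRows hR H).submatrix id e) k ≠ 0)
    (hε : ∀ r t, ‖scaledResidual hR hT H r t‖ ≤ ε) :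
    postSNR (H.submatrix id e) ρ₀ k ≤ ρ₀ * residualGain hR hT H e k * ε ^ 2 := by
  set v := signedMinors ((topRows hR H).submatrix id e) with hv
  have hdet' : 0 < ‖(leadingBlock hR hT H).det‖ := norm_pos_iff.2 hdet
  have hk' : 0 < ‖v k‖ := norm_pos_iff.2 hk
  have hr : ∀ r, ‖(H.submatrix id e *ᵥ v) r‖ ≤
      ε * ((∑ i, ‖v i‖) / ‖(leadingBlock hR hT H).det‖) := by
    intro r
    rw [← mul_div_assoc, le_div_iff₀ hdet', mul_comm, ← norm_mul, det_mul_mulVec_signedMinors,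
      Finset.mul_sum]
    refine norm_sum_le_of_le _ fun i _ => ?_
    rw [norm_mul]
    gcongr
    exact hε _ _
  have hsum : ∑ r, ‖(H.submatrix id e *ᵥ v) r‖ ^ 2 ≤
      NR * (ε * ((∑ i, ‖v i‖) / ‖(leadingBlock hR hT H).det‖)) ^ 2 := by
    calc _ ≤ ∑ _r : Fin NR, (ε * ((∑ i, ‖v i‖) / ‖(leadingBlock hR hT H).det‖)) ^ 2 :=
          Finset.sum_le_sum fun r _ => pow_le_pow_left₀ (norm_nonneg _) (hr r) 2
      _ = _ := by simp
  have hm : ρ₀ / ((m + 1 : ℕ) : ℝ) ≤ ρ₀ := div_le_self hρ (by simp)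
  have key := (postSNR_mul_norm_sq_le (H.submatrix id e) hρ k v).trans
    (mul_le_mul hm hsum (by positivity) hρ)
  rw [← le_div_iff₀ (by positivity)] at key
  refine key.trans (le_of_eq ?_)
  rw [residualGain, ← hv]
  ring

theorem continuous_det_leadingBlock :
    Continuous fun H : Matrix (Fin NR) (Fin NT) ℂ => (leadingBlock hR hT H).det :=
  Continuous.matrix_det (continuous_id.matrix_submatrix _ _)

theorem continuous_scaledPrediction (r : Fin NR) (t : Fin NT) :
    Continuous fun H : Matrix (Fin NR) (Fin NT) ℂ => scaledPrediction hR hT H r t :=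
  Continuous.dotProduct (continuous_pi fun _ => continuous_id.matrix_elem _ _)
    (Continuous.matrix_mulVec (Continuous.matrix_adjugate (continuous_id.matrix_submatrix _ _))
      (continuous_pi fun _ => continuous_id.matrix_elem _ _))

theorem continuous_scaledResidual (r : Fin NR) (t : Fin NT) :
    Continuous fun H : Matrix (Fin NR) (Fin NT) ℂ => scaledResidual hR hT H r t :=
  ((continuous_det_leadingBlock hR hT).mul (continuous_id.matrix_elem r t)).sub
    (continuous_scaledPrediction hR hT r t)

/-- All these quantities are continuous at `H₀` and finite in number, so one constant serves near
`H₀`. -/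
theorem exists_nhds_bounds {H₀ : Matrix (Fin NR) (Fin NT) ℂ}
    (hdet : (leadingBlock hR hT H₀).det ≠ 0)
    (hmin : ∀ (e : Fin (m + 1) ↪ Fin NT) k,
      signedMinors ((topRows hR H₀).submatrix id e) k ≠ 0) :
    ∃ C : ℝ, 0 < C ∧ ∀ᶠ H in nhds H₀, (leadingBlock hR hT H).det ≠ 0 ∧
      ‖(leadingBlock hR hT H).det‖ ≤ C ∧
      (∀ r t, ‖scaledPrediction hR hT H r t / (leadingBlock hR hT H).det‖ ≤ C) ∧
      ∀ (e : Fin (m + 1) ↪ Fin NT) k,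
        signedMinors ((topRows hR H).submatrix id e) k ≠ 0 ∧ residualGain hR hT H e k ≤ C := by
  have hbdd : ∀ f : Matrix (Fin NR) (Fin NT) ℂ → ℝ, ContinuousAt f H₀ →
      ∀ᶠ C in atTop, ∀ᶠ H in nhds H₀, f H ≤ C := by
    intro f hf
    filter_upwards [eventually_gt_atTop (f H₀)] with C hC
    exact (hf.eventually (gt_mem_nhds hC)).mono fun _ h => le_of_lt h
  have hcdet := continuous_det_leadingBlock hR hT
  have hcpred := continuous_scaledPrediction hR hT
  have hcmin : ∀ (e : Fin (m + 1) ↪ Fin NT) k, Continuous fun H : Matrix (Fin NR) (Fin NT) ℂ =>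
      signedMinors ((topRows hR H).submatrix id e) k := fun e k =>
    continuous_const.mul (Continuous.matrix_det (((continuous_id.matrix_submatrix _ _
      ).matrix_submatrix _ _).matrix_submatrix _ _))
  have hcgain : ∀ (e : Fin (m + 1) ↪ Fin NT) k,
      ContinuousAt (fun H => residualGain hR hT H e k) H₀ := by
    intro e k
    refine ContinuousAt.div (continuousAt_const.mul ((ContinuousAt.div (continuous_finsetSum _
      fun i _ => (hcmin e i).norm).continuousAt hcdet.norm.continuousAt ?_).pow 2))
      ((hcmin e k).norm.pow 2).continuousAt ?_
    · exact norm_ne_zero_iff.2 hdet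
    · exact pow_ne_zero 2 (norm_ne_zero_iff.2 (hmin e k))
  obtain ⟨C, hC0, hC1, hC2, hC3⟩ := ((eventually_gt_atTop (0 : ℝ)).and
    ((hbdd _ hcdet.norm.continuousAt).and
    ((eventually_all.2 fun q : Fin NR × Fin NT => hbdd _
      (((hcpred q.1 q.2).continuousAt.div hcdet.continuousAt hdet).norm)).and
    (eventually_all.2 fun q : (Fin (m + 1) ↪ Fin NT) × Fin (m + 1) =>
      hbdd _ (hcgain q.1 q.2))))).exists
  refine ⟨C, hC0, ?_⟩
  filter_upwards [hcdet.continuousAt.eventually_ne hdet, hC1, eventually_all.2 hC2,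
    eventually_all.2 hC3, eventually_all.2 fun q : (Fin (m + 1) ↪ Fin NT) × Fin (m + 1) =>
      (hcmin q.1 q.2).continuousAt.eventually_ne (hmin q.1 q.2)] with H h1 h2 h3 h4 h5
  exact ⟨h1, h2, fun r t => h3 (r, t), fun e k => ⟨h5 (e, k), h4 (e, k)⟩⟩

/-- The matrix whose columns are the vectors of powers of pairwise distinct numbers. -/
def powerMatrix (NR NT : ℕ) : Matrix (Fin NR) (Fin NT) ℂ :=
  Matrix.of fun r t => ((t : ℕ) : ℂ) ^ (r : ℕ)

/-- Columns with distinct nodes form a transposed Vandermonde matrix. Thus no maximal minor of the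
top rows vanishes, whichever columns are selected. -/
theorem det_powerMatrix_submatrix_ne_zero {e : Fin m → Fin NT} (he : Function.Injective e) :
    ((powerMatrix NR NT).submatrix (Fin.castLE hR) e).det ≠ 0 := by
  have : (powerMatrix NR NT).submatrix (Fin.castLE hR) e =
      (Matrix.vandermonde fun i => (((e i : Fin NT) : ℕ) : ℂ))ᵀ := by
    ext; simp [powerMatrix, Matrix.vandermonde_apply]
  rw [this, Matrix.det_transpose, Matrix.det_vandermonde_ne_zero_iff]
  exact fun i j h => he (Fin.ext (Nat.cast_injective h))

theorem signedMinors_powerMatrix_ne_zero (e : Fin (m + 1) ↪ Fin NT) (k : Fin (m + 1)) :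
    signedMinors ((topRows hR (powerMatrix NR NT)).submatrix id e) k ≠ 0 := by
  refine mul_ne_zero (pow_ne_zero _ (by norm_num)) ?_
  exact det_powerMatrix_submatrix_ne_zero hR
    (e := e ∘ k.succAbove) (e.injective.comp Fin.succAbove_right_injective)

end LowRank

/-! ### The event of low SNR for every selection -/

theorem card_lowerRightBlock (NR NT m : ℕ) :
    Fintype.card {q : Fin NR × Fin NT // ¬ ((q.1 : ℕ) < m ∨ (q.2 : ℕ) < m)} =
      (NR - m) * (NT - m) := by
  have hcard : ∀ n, (Finset.univ.filter fun i : Fin n => ¬ ((i : ℕ) < m)).card = n - m := by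
    intro n
    rw [Finset.filter_not, Finset.card_sdiff_of_subset (Finset.filter_subset _ _),
      Fin.card_filter_val_lt]
    simp
    omega
  rw [Fintype.card_subtype, ← hcard NR, ← hcard NT, ← Finset.card_product]
  congr 1
  ext q
  simp

theorem exists_lowSNR_event {NR NT m : ℕ} (hR : m ≤ NR) (hT : m ≤ NT) :
    ∃ M c : ℝ, 0 < M ∧ 0 < c ∧ ∀ δ : ℝ, 0 < δ → δ ≤ 1 → ∃ S : Set (Fin NR × Fin NT → ℂ),
      MeasurableSet S ∧
      ENNReal.ofReal (c * (δ ^ 2) ^ ((NR - m) * (NT - m))) ≤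
        Measure.pi (fun _ => stdComplexGaussian) S ∧
      ∀ h ∈ S, ∀ (e : Fin (m + 1) ↪ Fin NT) (k : Fin (m + 1)) (ρ₀ : ℝ), 0 ≤ ρ₀ →
        postSNR ((Matrix.of fun r t => h (r, t)).submatrix id e) ρ₀ k ≤ ρ₀ * M * δ ^ 2 := by
  set p : Fin NR × Fin NT → Prop := fun q => (q.1 : ℕ) < m ∨ (q.2 : ℕ) < m with hp
  set split := Equiv.piEquivPiSubtypeProd p fun _ => ℂ with hsplit
  set toMat : (Fin NR × Fin NT → ℂ) → Matrix (Fin NR) (Fin NT) ℂ :=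
    fun h => Matrix.of fun r t => h (r, t) with htoMat
  -- Minors, leading block and predictions see only the first `m` rows and columns, so the remaining
  -- entries may be filled with zeros.
  set z : ({q // p q} → ℂ) → Matrix (Fin NR) (Fin NT) ℂ := fun x => toMat (split.symm (x, 0))
    with hz
  have hentry : ∀ x y r t, p (r, t) → toMat (split.symm (x, y)) r t = z x r t := by
    intro x y r t hq
    simp only [htoMat, hz, hsplit, Matrix.of_apply, Equiv.piEquivPiSubtypeProd_symm_apply,
      dif_pos hq]
  have htop : ∀ x y, topRows hR (toMat (split.symm (x, y))) = topRows hR (z x) := by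
    intro x y
    ext s t
    exact hentry x y _ _ (Or.inl s.2)
  have hlead : ∀ x y, leadingBlock hR hT (toMat (split.symm (x, y))) =
      leadingBlock hR hT (z x) := by
    intro x y
    ext s t
    exact hentry x y _ _ (Or.inl s.2)
  have hpred : ∀ x y r t, scaledPrediction hR hT (toMat (split.symm (x, y))) r t =
      scaledPrediction hR hT (z x) r t := by
    intro x y r t
    rw [scaledPrediction, scaledPrediction, hlead, htop]
    congr 1
    ext s
    exact hentry x y _ _ (Or.inr s.2)
  have hzcont : Continuous z := by
    refine continuous_pi fun r => continuous_pi fun t => ?_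
    by_cases hq : p (r, t)
    · simp only [hz, htoMat, hsplit, Matrix.of_apply, Equiv.piEquivPiSubtypeProd_symm_apply,
        dif_pos hq]
      exact continuous_apply _
    · simp only [hz, htoMat, hsplit, Matrix.of_apply, Equiv.piEquivPiSubtypeProd_symm_apply,
        dif_neg hq]
      exact continuous_const
  set h₀ : Fin NR × Fin NT → ℂ := fun q => powerMatrix NR NT q.1 q.2 with hh₀
  set x₀ := (split h₀).1 with hx₀
  have hback : toMat (split.symm (x₀, (split h₀).2)) = powerMatrix NR NT := by
    rw [hx₀, Prod.mk.eta, Equiv.symm_apply_apply]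
    rfl
  obtain ⟨C, hC, hev⟩ := exists_nhds_bounds hR hT (H₀ := z x₀)
    (by
      rw [← hlead x₀ (split h₀).2, hback]
      exact det_powerMatrix_submatrix_ne_zero hR (Fin.castLE_injective hT))
    (fun e k => by
      rw [← htop x₀ (split h₀).2, hback]
      exact signedMinors_powerMatrix_ne_zero hR e k)
  obtain ⟨U, hU, hUo, hxU⟩ := eventually_nhds_iff.1 (hzcont.continuousAt.eventually hev)
  obtain ⟨c, hc, hS⟩ := pi_stdComplexGaussian_lower_bound p (hUo.mem_nhds hxU)
    (fun x q => scaledPrediction hR hT (z x) q.1.1 q.1.2 / (leadingBlock hR hT (z x)).det) C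
    (fun x hx q => (hU x hx).2.2.1 _ _)
  -- A gain at most `C` and residuals below `C * δ` (determinant at most `C`, deviation below `δ`)
  -- give `C * (C * δ) ^ 2`.
  refine ⟨C ^ 3, c, by positivity, hc, fun δ hδ hδ1 => ⟨{h | (split h).1 ∈ U ∧
    ∀ r t, ‖scaledResidual hR hT (toMat h) r t‖ < C * δ}, ?_, ?_, ?_⟩⟩
  · refine IsOpen.measurableSet ?_
    have hmat : Continuous toMat := continuous_pi fun r => continuous_pi fun t =>
      continuous_apply (r, t)
    have hsp : Continuous fun h => (split h).1 := continuous_pi fun q => continuous_apply q.1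
    simp only [Set.ofPred_and, Set.ofPred_forall]
    exact (hUo.preimage hsp).inter (isOpen_iInter_of_finite fun r => isOpen_iInter_of_finite
      fun t => isOpen_lt ((continuous_scaledResidual hR hT r t).comp hmat).norm continuous_const)
  · rw [← card_lowerRightBlock]
    refine hS δ hδ hδ1 _ fun x hx y hy => ⟨?_, fun r t => ?_⟩
    · rwa [Equiv.apply_symm_apply]
    · by_cases hq : p (r, t)
      · have : scaledResidual hR hT (toMat (split.symm (x, y))) r t = 0 := by
          rcases hq with hq | hq
          · exact scaledResidual_of_lt_row hR hT _ hq t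
          · exact scaledResidual_of_lt_col hR hT _ r hq
        rw [this, norm_zero]
        positivity
      · obtain ⟨hd, hdC, -, -⟩ := hU x hx
        have hyq : toMat (split.symm (x, y)) r t = y ⟨(r, t), hq⟩ := by
          simp only [htoMat, hsplit, Matrix.of_apply, Equiv.piEquivPiSubtypeProd_symm_apply,
            dif_neg hq]
        have : scaledResidual hR hT (toMat (split.symm (x, y))) r t =
            (leadingBlock hR hT (z x)).det * (y ⟨(r, t), hq⟩ -
              scaledPrediction hR hT (z x) r t / (leadingBlock hR hT (z x)).det) := by
          rw [scaledResidual, hpred, hlead, hyq, mul_sub, mul_div_cancel₀ _ hd]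
        rw [this, norm_mul]
        exact mul_lt_mul' hdC (hy ⟨(r, t), hq⟩) (norm_nonneg _) hC
  · rintro h ⟨hhU, hres⟩ e k ρ₀ hρ
    have hh : toMat h = toMat (split.symm ((split h).1, (split h).2)) := by
      rw [Prod.mk.eta, Equiv.symm_apply_apply]
    obtain ⟨hd, -, -, hg⟩ := hU _ hhU
    obtain ⟨hk, hgain⟩ := hg e k
    have hgain' : residualGain hR hT (toMat h) e k = residualGain hR hT (z (split h).1) e k := by
      rw [hh, residualGain, residualGain, hlead, htop]
    refine (postSNR_le_residualGain hR hT (toMat h) e k hρ ?_ ?_ fun r t => (hres r t).le).trans ?_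
    · rwa [hh, hlead]
    · rwa [hh, htop]
    · rw [hgain']
      calc _ ≤ ρ₀ * C * (C * δ) ^ 2 := by gcongr
        _ = _ := by ring

/-! ### From the probability bound to the exponent -/

theorem IsRayleighChannel.hasLaw_pi {Ω : Type*} [MeasurableSpace Ω] {P : Measure Ω}
    [IsProbabilityMeasure P] {NR NT : ℕ} {H : Ω → Matrix (Fin NR) (Fin NT) ℂ}
    (hH : IsRayleighChannel P H) :
    HasLaw (fun ω (q : Fin NR × Fin NT) => H ω q.1 q.2)
      (Measure.pi fun _ => stdComplexGaussian) P := by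
  have hm : ∀ q : Fin NR × Fin NT, AEMeasurable (fun ω => H ω q.1 q.2) P :=
    fun q => (hH.hasLaw q.1 q.2).aemeasurable
  refine ⟨aemeasurable_pi_lambda _ hm, ?_⟩
  rw [(iIndepFun_iff_map_fun_eq_pi_map hm).1 hH.indep]
  congr 1
  ext1 q
  exact (hH.hasLaw q.1 q.2).map_eq

/-- Dividing by the negative `log ρ⁻¹` reverses the bound, and the constant's share `log c / log ρ`
vanishes in the limit. -/
theorem limsup_log_div_log_inv_le {f : ℝ → ENNReal} (hf : ∀ ρ, f ρ ≤ 1) {c : ℝ} (hc : 0 < c) (d : ℕ)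
    (h : ∀ᶠ ρ in atTop, ENNReal.ofReal (c * ρ⁻¹ ^ d) ≤ f ρ) :
    limsup (fun ρ : ℝ => ENNReal.log (f ρ) / ((Real.log ρ⁻¹ : ℝ) : EReal)) atTop ≤ ((d : ℝ) : EReal) := by
  have hlim : Tendsto (fun ρ : ℝ => ((d - Real.log c / Real.log ρ : ℝ) : EReal)) atTop
      (nhds ((d : ℝ) : EReal)) := by
    refine (continuous_coe_real_ereal.tendsto _).comp ?_
    simpa using tendsto_const_nhds.sub (Tendsto.div_atTop (tendsto_const_nhds (x := Real.log c))
      Real.tendsto_log_atTop)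
  rw [← hlim.limsup_eq]
  refine limsup_le_limsup ?_
  filter_upwards [h, eventually_gt_atTop 1] with ρ hρ hρ1
  have hρ0 : 0 < ρ := one_pos.trans hρ1
  have hpos : 0 < c * ρ⁻¹ ^ d := by positivity
  have hfin : f ρ ≠ ⊤ := ((hf ρ).trans_lt ENNReal.one_lt_top).ne
  have hle : c * ρ⁻¹ ^ d ≤ (f ρ).toReal := (ENNReal.ofReal_le_iff_le_toReal hfin).1 hρ
  have hlog : Real.log c - d * Real.log ρ ≤ Real.log (f ρ).toReal := by
    have := Real.log_le_log hpos hle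
    rw [Real.log_mul hc.ne' (by positivity), Real.log_pow, Real.log_inv] at this
    linarith
  have hlρ : 0 < Real.log ρ := Real.log_pos hρ1
  rw [ENNReal.log_pos_real (ENNReal.toReal_pos_iff.1 (hpos.trans_le hle)).1.ne' hfin,
    ← EReal.coe_div, EReal.coe_le_coe_iff, Real.log_inv, div_neg, ← neg_div, div_le_iff₀ hlρ,
    sub_mul, div_mul_cancel₀ _ hlρ.ne']
  linarith

theorem theorem1 {Ω : Type*} [MeasurableSpace Ω] (P : Measure Ω) [IsProbabilityMeasure P]
    (NR NT L : ℕ) (hL : 1 ≤ L) (hLmin : L ≤ min NR NT)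
    (H : Ω → Matrix (Fin NR) (Fin NT) ℂ) (hH : IsRayleighChannel P H)
    (φ : Matrix (Fin NR) (Fin NT) ℂ → AntennaSubset NT L) (hφ : Measurable φ)
    (γ : ℝ) (hγ : 0 < γ) :
    diversityUpper P H φ γ ≤
      ((((NT : ℝ) - (L : ℝ) + 1) * ((NR : ℝ) - (L : ℝ) + 1) : ℝ) : EReal) := by
  obtain ⟨m, rfl⟩ : ∃ m, L = m + 1 := ⟨L - 1, by omega⟩
  have hR : m ≤ NR := by omega
  have hT : m ≤ NT := by omega
  obtain ⟨M, c, hM, hc, hS⟩ := exists_lowSNR_event hR hT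
  have hd : ((NT : ℝ) - ((m + 1 : ℕ) : ℝ) + 1) * ((NR : ℝ) - ((m + 1 : ℕ) : ℝ) + 1) =
      (((NR - m) * (NT - m) : ℕ) : ℝ) := by
    push_cast [hR, hT]
    ring
  rw [hd]
  refine limsup_log_div_log_inv_le (fun ρ => prob_le_one)
    (c := c * (γ / M) ^ ((NR - m) * (NT - m))) (by positivity) _ ?_
  filter_upwards [eventually_ge_atTop (γ / M), eventually_gt_atTop 0] with ρ hρ hρ0
  have hδ : 0 < γ / (M * ρ) := by positivity
  have hδ1 : γ / (M * ρ) ≤ 1 := by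
    rw [div_le_one (by positivity), mul_comm]
    exact (div_le_iff₀ hM).1 hρ
  -- This `δ` solves `ρ * M * δ ^ 2 = γ`; `ρ ≥ γ / M` ensures `δ ≤ 1`.
  obtain ⟨S, hSm, hSP, hSsnr⟩ := hS (Real.sqrt (γ / (M * ρ))) (Real.sqrt_pos.2 hδ)
    (Real.sqrt_le_one.2 hδ1)
  rw [Real.sq_sqrt hδ.le] at hSP hSsnr
  calc ENNReal.ofReal (c * (γ / M) ^ ((NR - m) * (NT - m)) * ρ⁻¹ ^ ((NR - m) * (NT - m)))
      = ENNReal.ofReal (c * (γ / (M * ρ)) ^ ((NR - m) * (NT - m))) := by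
        rw [mul_assoc, ← mul_pow, ← div_eq_mul_inv, div_div]
    _ ≤ Measure.pi (fun _ => stdComplexGaussian) S := hSP
    _ = P ((fun ω (q : Fin NR × Fin NT) => H ω q.1 q.2) ⁻¹' S) := by
        rw [← hH.hasLaw_pi.map_eq, Measure.map_apply_of_aemeasurable hH.hasLaw_pi.aemeasurable hSm]
    _ ≤ _ := by
        refine measure_mono fun ω hω => ?_
        refine ciSup_le (f := fun k => postSNR _ ρ k) fun k => ?_
        refine (hSsnr _ hω ((φ (H ω)).1.orderEmbOfFin (φ (H ω)).2).toEmbedding k ρ hρ0.le).trans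
          (le_of_eq ?_)
        field_simp
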